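/- Let $D\ge 1$, let $\mathcal X=\{\mathbf x_i\}_{i=1}^N\subset\mathbb R^D$ be a data set, and let $\delta>0$. Assume that $$(\mathcal X\cap \mathrm L_1)\cup(\mathcal X\cap \mathrm L_2)\neq\mathcal X\quad\text{for all $(D-1)$-dimensional linear subspaces } \mathrm L_1,\mathrm L_2\subset\mathbb R^D .$$ Let $\mathbb H=\{\mathbf Q\in\mathbb R^{D\times D}:\mathbf Q=\mathbf Q^T,\ \operatorname{tr}(\mathbf Q)=1\}$ and, with $\|\cdot\|$ the Euclidean norm, $$F_\delta(\mathbf Q)=\sum_{i:\,\|\mathbf Q\mathbf x_i\|\ge\delta}\|\mathbf Q\mathbf x_i\|+\sum_{i:\,\|\mathbf Q\mathbf x_i\|<\delta}\left(\frac{\|\mathbf Q\mathbf x_i\|^2}{2\delta}+\frac{\delta}{2}\right).$$ Then $F_\delta$ has a unique minimizer $\hat{\mathbf Q}_\delta$ in $\mathbb H$. For every $\mathbf Q_0\in\mathbb H$ the regularized IRLS iteration $$\mathbf Q_{k+1}=\mathbf A_k^{-1}/\operatorname{tr}(\mathbf A_k^{-1}),\qquad \mathbf A_k=\sum_{i=1}^N\frac{\mathbf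 x_i\mathbf x_i^T}{\max(\|\mathbf Q_k\mathbf x_i\|,\delta)},\qquad k=0,1,2,\dots,$$ is well defined (each $\mathbf A_k$ is invertible and $\operatorname{tr}(\mathbf A_k^{-1})\ne 0$), and $\mathbf Q_k$ converges linearly to $\hat{\mathbf Q}_\delta$: there is a number $r\in(0,1)$, depending only on $\mathcal X$ and $\delta$, and for every $\mathbf Q_0\in\mathbb H$ there is a constant $C>0$ such that $$\|\mathbf Q_k-\hat{\mathbf Q}_\delta\|_F\le C\,r^k\qquad\text{for all } k\ge 0 ,$$ where $\|\cdot\|_F$ is the Frobenius norm. -/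

import Mathlib

attribute [local instance] Matrix.frobeniusNormedAddCommGroup

namespace IRLS

noncomputable section

/-- The set `ℍ` of real symmetric `D × D` matrices of trace one. -/
def traceOne (D : ℕ) : Set (Matrix (Fin D) (Fin D) ℝ) :=
  {Q | Q.IsSymm ∧ Q.trace = 1}

/-- The two-hyperplane condition: the data set is not contained in a union of two
linear subspaces of dimension `D - 1`. -/
def TwoHyperplaneCondition {D N : ℕ} (x : Fin N → EuclideanSpace ℝ (Fin D)) : Prop :=
  ∀ L₁ L₂ : Submodule ℝ (EuclideanSpace ℝ (Fin D)),
    Module.finrank ℝ L₁ + 1 = D → Module.finrank ℝ L₂ + 1 = D →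
      (Set.range x ∩ (L₁ : Set (EuclideanSpace ℝ (Fin D)))) ∪
        (Set.range x ∩ (L₂ : Set (EuclideanSpace ℝ (Fin D)))) ≠ Set.range x

/-- The Euclidean norm `‖Q v‖` of a matrix-vector product. -/
def residual {D : ℕ} (Q : Matrix (Fin D) (Fin D) ℝ) (v : EuclideanSpace ℝ (Fin D)) : ℝ :=
  ‖WithLp.toLp 2 (Q.mulVec v.ofLp)‖

/-- The regularized energy `F_δ`. -/
def regEnergy {D N : ℕ} (δ : ℝ) (x : Fin N → EuclideanSpace ℝ (Fin D))
    (Q : Matrix (Fin D) (Fin D) ℝ) : ℝ :=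
  (∑ i with δ ≤ residual Q (x i), residual Q (x i)) +
    ∑ i with residual Q (x i) < δ, ((residual Q (x i)) ^ 2 / (2 * δ) + δ / 2)

/-- The weighted covariance matrix `∑ᵢ xᵢ xᵢᵀ / max (‖Q xᵢ‖, δ)`. -/
def weightedCov {D N : ℕ} (δ : ℝ) (x : Fin N → EuclideanSpace ℝ (Fin D))
    (Q : Matrix (Fin D) (Fin D) ℝ) : Matrix (Fin D) (Fin D) ℝ :=
  ∑ i, (max (residual Q (x i)) δ)⁻¹ • Matrix.vecMulVec (x i).ofLp (x i).ofLp

/-- One step of the regularized IRLS iteration: the inverse of the weighted covariance,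
scaled to have trace one. -/
def irlsStep {D N : ℕ} (δ : ℝ) (x : Fin N → EuclideanSpace ℝ (Fin D))
    (Q : Matrix (Fin D) (Fin D) ℝ) : Matrix (Fin D) (Fin D) ℝ :=
  ((weightedCov δ x Q)⁻¹.trace)⁻¹ • (weightedCov δ x Q)⁻¹

/-- The regularized IRLS sequence `Q_0, Q_1, Q_2, …` started from `Q₀`. -/
def irlsSeq {D N : ℕ} (δ : ℝ) (x : Fin N → EuclideanSpace ℝ (Fin D))
    (Q₀ : Matrix (Fin D) (Fin D) ℝ) : ℕ → Matrix (Fin D) (Fin D) ℝ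
  | 0 => Q₀
  | k + 1 => irlsStep δ x (irlsSeq δ x Q₀ k)

/-- `Qhat` is the unique minimizer of `F_δ` on `ℍ`. -/
def IsUniqueMinimizer {D N : ℕ} (δ : ℝ) (x : Fin N → EuclideanSpace ℝ (Fin D))
    (Qhat : Matrix (Fin D) (Fin D) ℝ) : Prop :=
  (Qhat ∈ traceOne D ∧ IsMinOn (regEnergy δ x) (traceOne D) Qhat) ∧
    ∀ Q ∈ traceOne D, IsMinOn (regEnergy δ x) (traceOne D) Q → Q = Qhat

end

end IRLS

/-! Freezing the weights `1 / max (‖Q xᵢ‖, δ)` at the current `Q` gives a quadratic majorant of the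
energy that touches it at `Q`. The trace-one minimizer of this quadratic is `irlsStep`: multiplied
by the weighted covariance it is a multiple of the identity, hence weighted-orthogonal to every
traceless matrix. So each step lowers the energy (`regEnergy_irlsStep_le`) and lands in the compact
set of density matrices. This gives existence of a minimizer and shows that every minimizer is a
fixed point, hence positive definite.

Uniqueness and the rate come from strong convexity at points of a compact set of positive definite
matrices (`exists_strongConvexity`). The Bregman divergence of each summand dominates the Gram
determinant of `Q xᵢ` and `P xᵢ`. If all of these vanish for a traceless `P`, the data lie in the
kernel and range of one singular matrix, which the two-hyperplane condition forbids unless `P = 0`.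
Compactness supplies a uniform constant `μ`. With the bound `L` on the quadratics, a step contracts
the energy gap by `1 - μ / L`; quadratic growth at the minimizer turns this into the rate `√(1 - μ /
L)` for the distance. -/

namespace IRLS

open Matrix

attribute [local instance] Matrix.frobeniusNormedSpace

/-! ### Consequences of the two-hyperplane condition -/

section Geometry

variable {D N : ℕ} {x : Fin N → EuclideanSpace ℝ (Fin D)}

lemma exists_finrank_add_one_of_ne_top {E : Type*} [AddCommGroup E] [Module ℝ E]
    [FiniteDimensional ℝ E] {p : Submodule ℝ E} (hp : p ≠ ⊤) :
    ∃ L : Submodule ℝ E, p ≤ L ∧ Module.finrank ℝ L + 1 = Module.finrank ℝ E := by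
  obtain ⟨f, hf, hpf⟩ := Submodule.exists_le_ker_of_lt_top p (lt_top_iff_ne_top.2 hp)
  refine ⟨LinearMap.ker f, hpf, ?_⟩
  have := f.finrank_range_add_finrank_ker
  rw [LinearMap.range_eq_top.2 (LinearMap.surjective hf), finrank_top, Module.finrank_self] at this
  omega

/-- No two proper subspaces cover a data set with the two-hyperplane property. -/
lemma TwoHyperplaneCondition.exists_notMem (hx : TwoHyperplaneCondition x)
    {p q : Submodule ℝ (Fin D → ℝ)} (hp : p ≠ ⊤) (hq : q ≠ ⊤) :
    ∃ i, (x i).ofLp ∉ p ∧ (x i).ofLp ∉ q := by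
  obtain ⟨p', hpp, hp'⟩ := exists_finrank_add_one_of_ne_top hp
  obtain ⟨q', hqq, hq'⟩ := exists_finrank_add_one_of_ne_top hq
  rw [Module.finrank_fin_fun] at hp' hq'
  let e := WithLp.linearEquiv 2 ℝ (Fin D → ℝ)
  have hfin (L : Submodule ℝ (Fin D → ℝ)) :
      Module.finrank ℝ (L.comap (e : EuclideanSpace ℝ (Fin D) →ₗ[ℝ] Fin D → ℝ)) =
        Module.finrank ℝ L :=
    LinearEquiv.finrank_eq (e.submoduleMap _ ≪≫ₗ
      LinearEquiv.ofEq _ _ (Submodule.map_comap_eq_of_surjective e.surjective L))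
  have h := hx (p'.comap e.toLinearMap) (q'.comap e.toLinearMap)
    (by rw [hfin]; exact hp') (by rw [hfin]; exact hq')
  by_contra! hcon
  refine h (Set.Subset.antisymm (by simp) ?_)
  rintro _ ⟨i, rfl⟩
  by_cases hi : (x i).ofLp ∈ p
  · exact Or.inl ⟨⟨i, rfl⟩, hpp hi⟩
  · exact Or.inr ⟨⟨i, rfl⟩, hqq (hcon i hi)⟩

lemma TwoHyperplaneCondition.eq_zero_of_mulVec (hx : TwoHyperplaneCondition x)
    {R : Matrix (Fin D) (Fin D) ℝ} (h : ∀ i, R *ᵥ (x i).ofLp = 0) : R = 0 := by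
  by_contra hR
  have hker : LinearMap.ker (Matrix.toLin' R) ≠ ⊤ := fun h0 => hR <| by
    simpa using LinearMap.ker_eq_top.1 h0
  obtain ⟨i, hi, -⟩ := hx.exists_notMem hker hker
  exact hi (by simpa using h i)

lemma TwoHyperplaneCondition.eq_zero_of_dotProduct (hx : TwoHyperplaneCondition x)
    {v : Fin D → ℝ} (h : ∀ i, (x i).ofLp ⬝ᵥ v = 0) : v = 0 := by
  by_contra hv
  have hker : LinearMap.ker (dotProductBilin ℝ ℝ v) ≠ ⊤ := fun h0 => hv <| by
    have h1 : v ∈ LinearMap.ker (dotProductBilin ℝ ℝ v) := h0 ▸ Submodule.mem_top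
    simpa using h1
  obtain ⟨i, hi, -⟩ := hx.exists_notMem hker hker
  exact hi (by simpa [dotProduct_comm] using h i)

/-- A traceless matrix that sends each data point to a multiple of its image under an invertible
matrix vanishes. -/
lemma TwoHyperplaneCondition.eq_zero_of_parallel (hD : 0 < D) (hx : TwoHyperplaneCondition x)
    {Q P : Matrix (Fin D) (Fin D) ℝ} (hQ : IsUnit Q.det) (hQt : Q.trace ≠ 0) (hP : P.trace = 0)
    (h : ∀ i, ∃ c : ℝ, P *ᵥ (x i).ofLp = c • (Q *ᵥ (x i).ofLp)) : P = 0 := by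
  have : Nonempty (Fin D) := ⟨⟨0, hD⟩⟩
  choose c hc using h
  obtain ⟨i, hi, -⟩ := hx.exists_notMem (p := ⊥) (q := ⊥) bot_ne_top bot_ne_top
  have hi0 : (x i).ofLp ≠ 0 := by simpa using hi
  by_contra hP0
  -- Put `T = Q⁻¹ (P - cᵢ Q)`. It kills the nonzero `xᵢ`, so its range is proper, and `T xⱼ = (cⱼ -
  -- cᵢ) xⱼ` puts every data point in its kernel or its range. The trace condition makes the kernel
  -- proper.
  have hker : LinearMap.ker (Matrix.toLin' (P - c i • Q)) ≠ ⊤ := fun h0 => hP0 <| by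
    have h1 : P - c i • Q = 0 :=
      Matrix.toLin'.map_eq_zero_iff.1 (LinearMap.ker_eq_top.1 h0)
    have h2 : P = c i • Q := sub_eq_zero.1 h1
    have h3 : c i = 0 := by
      have := hP
      rw [h2, trace_smul, smul_eq_mul] at this
      exact (mul_eq_zero.1 this).resolve_right hQt
    rw [h2, h3, zero_smul]
  have hran : LinearMap.range (Matrix.toLin' (Q⁻¹ * (P - c i • Q))) ≠ ⊤ := fun h0 => by
    have h1 := LinearMap.ker_eq_bot_iff_range_eq_top.2 h0
    have h2 : (x i).ofLp ∈ LinearMap.ker (Matrix.toLin' (Q⁻¹ * (P - c i • Q))) := by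
      simp only [LinearMap.mem_ker, toLin'_apply, ← mulVec_mulVec, sub_mulVec, smul_mulVec, hc i,
        sub_self, mulVec_zero]
    rw [h1] at h2
    exact hi0 (by simpa using h2)
  obtain ⟨j, hj1, hj2⟩ := hx.exists_notMem hker hran
  have hval : (P - c i • Q) *ᵥ (x j).ofLp = (c j - c i) • (Q *ᵥ (x j).ofLp) := by
    rw [sub_mulVec, smul_mulVec, hc j, sub_smul]
  have hne : c j - c i ≠ 0 := fun h0 => hj1 (by
    rw [LinearMap.mem_ker, toLin'_apply, hval, h0, zero_smul])
  refine hj2 ⟨(c j - c i)⁻¹ • (x j).ofLp, ?_⟩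
  rw [toLin'_apply, mulVec_smul, ← mulVec_mulVec, hval, mulVec_smul, smul_smul,
    inv_mul_cancel₀ hne, one_smul, mulVec_mulVec, nonsing_inv_mul _ hQ, one_mulVec]

end Geometry

/-! ### Cauchy–Schwarz and Gram determinants -/

section Vectors

/-- Cauchy–Schwarz for the dot product, with explicit bounds on the lengths. -/
lemma dotProduct_le_mul {n : Type*} [Fintype n] (u v : n → ℝ) {s t : ℝ} (hs : 0 ≤ s) (ht : 0 ≤ t)
    (hu : u ⬝ᵥ u = s ^ 2) (hv : v ⬝ᵥ v = t ^ 2) : |u ⬝ᵥ v| ≤ s * t := by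
  refine abs_le_of_sq_le_sq ?_ (by positivity)
  have := Finset.sum_mul_sq_le_sq_mul_sq Finset.univ u v
  simp only [dotProduct, ← sq] at hu hv ⊢
  rw [mul_pow, ← hu, ← hv]
  exact this

/-- The Gram determinant of a pair of vectors. -/
def gramDet {n : Type*} [Fintype n] (u v : n → ℝ) : ℝ :=
  (u ⬝ᵥ u) * (v ⬝ᵥ v) - (u ⬝ᵥ v) ^ 2

lemma gramDet_nonneg {n : Type*} [Fintype n] (u v : n → ℝ) : 0 ≤ gramDet u v := by
  have := Finset.sum_mul_sq_le_sq_mul_sq Finset.univ u v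
  simp only [gramDet, dotProduct, ← sq]
  linarith

lemma gramDet_sub_right {n : Type*} [Fintype n] (u v : n → ℝ) :
    gramDet u (v - u) = gramDet u v := by
  simp only [gramDet, dotProduct_sub, sub_dotProduct, dotProduct_comm v u]
  ring

lemma gramDet_smul_right {n : Type*} [Fintype n] (u v : n → ℝ) (c : ℝ) :
    gramDet u (c • v) = c ^ 2 * gramDet u v := by
  simp only [gramDet, dotProduct_smul, smul_dotProduct, smul_eq_mul]
  ring

lemma exists_smul_eq_of_gramDet_eq_zero {n : Type*} [Fintype n] {u v : n → ℝ} (hu : u ≠ 0)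
    (h : gramDet u v = 0) : ∃ c : ℝ, v = c • u := by
  have hu' : u ⬝ᵥ u ≠ 0 := fun h0 => hu (dotProduct_self_eq_zero.1 h0)
  refine ⟨(u ⬝ᵥ v) / (u ⬝ᵥ u), sub_eq_zero.1 (dotProduct_self_eq_zero.1 ?_)⟩
  simp only [gramDet] at h
  simp only [dotProduct_sub, sub_dotProduct, dotProduct_smul, smul_dotProduct, smul_eq_mul,
    dotProduct_comm v u]
  field_simp
  linarith

end Vectors

/-! ### Inequalities for the regularized norm -/

section Huber

/-- The regularized absolute value lies above its tangents. -/
lemma huber_tangent {δ s t : ℝ} (hδ : 0 < δ) :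
    s ^ 2 / (2 * max s δ) + max s δ / 2 + s / max s δ * (t - s) ≤
      t ^ 2 / (2 * max t δ) + max t δ / 2 := by
  rcases le_total s δ with h1 | h1 <;> rcases le_total t δ with h2 | h2
  · rw [max_eq_right h1, max_eq_right h2, ← sub_nonneg]
    have : t ^ 2 / (2 * δ) + δ / 2 - (s ^ 2 / (2 * δ) + δ / 2 + s / δ * (t - s)) =
      (t - s) ^ 2 / (2 * δ) := by field_simp; ring
    rw [this]; positivity
  · have ht' : 0 < t := hδ.trans_le h2
    rw [max_eq_right h1, max_eq_left h2, ← sub_nonneg]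
    have : t ^ 2 / (2 * t) + t / 2 - (s ^ 2 / (2 * δ) + δ / 2 + s / δ * (t - s)) =
      (δ - s) * (2 * t - δ - s) / (2 * δ) := by field_simp; ring
    rw [this]
    exact div_nonneg (mul_nonneg (by linarith) (by linarith)) (by linarith)
  · have hs' : 0 < s := hδ.trans_le h1
    rw [max_eq_left h1, max_eq_right h2, ← sub_nonneg]
    have : t ^ 2 / (2 * δ) + δ / 2 - (s ^ 2 / (2 * s) + s / 2 + s / s * (t - s)) =
      (t - δ) ^ 2 / (2 * δ) := by field_simp; ring
    rw [this]; positivity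
  · have hs' : 0 < s := hδ.trans_le h1
    have ht' : 0 < t := hδ.trans_le h2
    rw [max_eq_left h1, max_eq_left h2]
    apply le_of_eq
    field_simp; ring

/-- The regularized absolute value lies below its quadratic majorants. -/
lemma huber_le_quadratic {δ s t : ℝ} (hδ : 0 < δ) (ht : 0 ≤ t) :
    t ^ 2 / (2 * max t δ) + max t δ / 2 ≤ t ^ 2 / (2 * max s δ) + max s δ / 2 := by
  have hs' : 0 < max s δ := hδ.trans_le (le_max_right _ _)
  have hsδ : δ ≤ max s δ := le_max_right _ _
  generalize max s δ = m at *
  -- Over `m ≥ δ`, the function `t² / (2m) + m / 2` is least at `m = max t δ`.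
  rcases le_total t δ with h | h
  · rw [max_eq_right h, ← sub_nonneg]
    have : t ^ 2 / (2 * m) + m / 2 - (t ^ 2 / (2 * δ) + δ / 2) =
      (m - δ) * (m * δ - t ^ 2) / (2 * m * δ) := by field_simp; ring
    rw [this]
    have : t ^ 2 ≤ m * δ := by nlinarith
    exact div_nonneg (mul_nonneg (by linarith) (by linarith)) (by positivity)
  · have ht' : 0 < t := hδ.trans_le h
    rw [max_eq_left h, ← sub_nonneg]
    have : t ^ 2 / (2 * m) + m / 2 - (t ^ 2 / (2 * t) + t / 2) = (m - t) ^ 2 / (2 * m) := by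
      field_simp; ring
    rw [this]; positivity

/-- The Bregman divergence of the regularized norm dominates the Gram determinant. -/
lemma gramDet_le_bregman {n : Type*} [Fintype n] {δ M s t : ℝ} (hδ : 0 < δ) {u v : n → ℝ}
    (hs : 0 ≤ s) (ht : 0 ≤ t) (hu : u ⬝ᵥ u = s ^ 2) (hv : v ⬝ᵥ v = t ^ 2)
    (hsM : s ≤ M) (htM : t ≤ M) (hδM : δ ≤ M) :
    s ^ 2 / (2 * max s δ) + max s δ / 2 + (max s δ)⁻¹ * (u ⬝ᵥ (v - u)) +
        (2 * M ^ 3)⁻¹ * gramDet u v ≤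
      t ^ 2 / (2 * max t δ) + max t δ / 2 := by
  have hT := huber_tangent (s := s) (t := t) hδ
  have hcs := abs_le.1 (dotProduct_le_mul u v hs ht hu hv)
  have hM : 0 < M := hδ.trans_le hδM
  have hm : 0 < max s δ := hδ.trans_le (le_max_right _ _)
  have hmM : max s δ ≤ M := max_le hsM hδM
  refine le_trans ?_ hT
  rw [dotProduct_sub, gramDet, hu, hv]
  generalize max s δ = m at *
  generalize u ⬝ᵥ v = b at *
  -- The radial part is covered by the tangent inequality; the Cauchy–Schwarz defect `m⁻¹ (s t - b)`
  -- remains. Factoring `s² t² - b²` and using `s t + b ≤ 2 M²` and `m ≤ M` gives the constant `2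
  -- M³`.
  have h1 : (2 * M ^ 3)⁻¹ * (s ^ 2 * t ^ 2 - b ^ 2) ≤ m⁻¹ * (s * t - b) := by
    have hst : s * t ≤ M ^ 2 := by nlinarith
    have h2 : s ^ 2 * t ^ 2 - b ^ 2 ≤ 2 * M ^ 2 * (s * t - b) := by nlinarith
    calc (2 * M ^ 3)⁻¹ * (s ^ 2 * t ^ 2 - b ^ 2) ≤ (2 * M ^ 3)⁻¹ * (2 * M ^ 2 * (s * t - b)) := by
          gcongr
      _ = M⁻¹ * (s * t - b) := by field_simp
      _ ≤ m⁻¹ * (s * t - b) := by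
          have : 0 ≤ s * t - b := by linarith
          gcongr
  have h3 : s / m * (t - s) = m⁻¹ * (s * t - b) + m⁻¹ * (b - s ^ 2) := by field_simp; ring
  linarith

end Huber

/-! ### The energy and its quadratic majorant -/

section Energy

variable {D N : ℕ}

lemma residual_nonneg (Q : Matrix (Fin D) (Fin D) ℝ) (v : EuclideanSpace ℝ (Fin D)) :
    0 ≤ residual Q v := norm_nonneg _

lemma dotProduct_mulVec_self (Q : Matrix (Fin D) (Fin D) ℝ) (v : EuclideanSpace ℝ (Fin D)) :
    (Q *ᵥ v.ofLp) ⬝ᵥ (Q *ᵥ v.ofLp) = residual Q v ^ 2 := by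
  rw [residual, EuclideanSpace.real_norm_sq_eq]
  simp [dotProduct, sq]

lemma continuous_residual (v : EuclideanSpace ℝ (Fin D)) :
    Continuous fun Q : Matrix (Fin D) (Fin D) ℝ => residual Q v :=
  continuous_norm.comp ((PiLp.continuous_toLp 2 _).comp
    (continuous_id.matrix_mulVec continuous_const))

/-- Both branches become one expression in `m = max t δ`; freezing `m` at another point then yields
the majorant. -/
lemma regEnergy_eq (δ : ℝ) (x : Fin N → EuclideanSpace ℝ (Fin D))
    (Q : Matrix (Fin D) (Fin D) ℝ) :
    regEnergy δ x Q = ∑ i, (residual Q (x i) ^ 2 / (2 * max (residual Q (x i)) δ) +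
      max (residual Q (x i)) δ / 2) := by
  rw [regEnergy, Finset.sum_filter, Finset.sum_filter, ← Finset.sum_add_distrib]
  refine Finset.sum_congr rfl fun i _ => ?_
  have h0 := residual_nonneg Q (x i)
  generalize residual Q (x i) = t at *
  rcases le_or_gt δ t with h | h
  · rw [if_pos h, if_neg h.not_gt, max_eq_left h]
    -- The sign of `δ` is free here, so `t = 0` can occur; division by zero then gives the right
    -- value `0`.
    rcases h0.eq_or_lt with rfl | h0
    · simp
    · field_simp; ring
  · rw [if_neg h.not_ge, if_pos h, max_eq_right h.le, zero_add]

variable {δ : ℝ} {x : Fin N → EuclideanSpace ℝ (Fin D)}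

lemma weight_pos (hδ : 0 < δ) (Q : Matrix (Fin D) (Fin D) ℝ) (v : EuclideanSpace ℝ (Fin D)) :
    0 < (max (residual Q v) δ)⁻¹ :=
  inv_pos.2 (hδ.trans_le (le_max_right _ _))

lemma continuous_weight (hδ : 0 < δ) (v : EuclideanSpace ℝ (Fin D)) :
    Continuous fun Q : Matrix (Fin D) (Fin D) ℝ => (max (residual Q v) δ)⁻¹ :=
  ((continuous_residual v).max continuous_const).inv₀ fun _ =>
    (hδ.trans_le (le_max_right _ _)).ne'

lemma continuous_regEnergy (hδ : 0 < δ) : Continuous (regEnergy δ x) := by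
  rw [funext (regEnergy_eq δ x)]
  refine continuous_finsetSum _ fun i _ => ?_
  have hm : Continuous fun Q : Matrix (Fin D) (Fin D) ℝ => max (residual Q (x i)) δ :=
    (continuous_residual (x i)).max continuous_const
  refine Continuous.add (Continuous.div₀ ((continuous_residual _).pow 2) (hm.const_mul 2)
    fun Q => ?_) (hm.div_const 2)
  have := hδ.trans_le (le_max_right (residual Q (x i)) δ)
  positivity

/-- The weighted inner product `∑ᵢ ⟨R xᵢ, P xᵢ⟩ / max (‖Q xᵢ‖, δ)`. -/
noncomputable def weightedInner (δ : ℝ) (x : Fin N → EuclideanSpace ℝ (Fin D))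
    (Q R P : Matrix (Fin D) (Fin D) ℝ) : ℝ :=
  ∑ i, (max (residual Q (x i)) δ)⁻¹ * ((R *ᵥ (x i).ofLp) ⬝ᵥ (P *ᵥ (x i).ofLp))

lemma weightedInner_comm (Q R P : Matrix (Fin D) (Fin D) ℝ) :
    weightedInner δ x Q R P = weightedInner δ x Q P R := by
  simp only [weightedInner, dotProduct_comm]

lemma weightedInner_add_right (Q R P P' : Matrix (Fin D) (Fin D) ℝ) :
    weightedInner δ x Q R (P + P') = weightedInner δ x Q R P + weightedInner δ x Q R P' := by
  simp only [weightedInner, add_mulVec, dotProduct_add, mul_add, Finset.sum_add_distrib]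

lemma weightedInner_smul_right (Q R P : Matrix (Fin D) (Fin D) ℝ) (c : ℝ) :
    weightedInner δ x Q R (c • P) = c * weightedInner δ x Q R P := by
  simp only [weightedInner, smul_mulVec, dotProduct_smul, smul_eq_mul, Finset.mul_sum]
  exact Finset.sum_congr rfl fun i _ => by ring

lemma weightedInner_eq_trace (Q R P : Matrix (Fin D) (Fin D) ℝ) :
    weightedInner δ x Q R P = (R * weightedCov δ x Q * Pᵀ).trace := by
  simp only [weightedInner, weightedCov, Finset.mul_sum, Finset.sum_mul, trace_sum, Matrix.mul_smul,
    Matrix.smul_mul, trace_smul, smul_eq_mul, mul_vecMulVec, vecMulVec_mul, trace_vecMulVec,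
    vecMul_transpose]

lemma weightedInner_add_self (Q R P : Matrix (Fin D) (Fin D) ℝ) :
    weightedInner δ x Q (R + P) (R + P) = weightedInner δ x Q R R +
      2 * weightedInner δ x Q R P + weightedInner δ x Q P P := by
  rw [weightedInner_add_right, weightedInner_comm Q (R + P) R, weightedInner_comm Q (R + P) P,
    weightedInner_add_right, weightedInner_add_right, weightedInner_comm Q P R]
  ring

lemma weightedInner_self_nonneg (hδ : 0 < δ) (Q R : Matrix (Fin D) (Fin D) ℝ) :
    0 ≤ weightedInner δ x Q R R :=
  Finset.sum_nonneg fun i _ => mul_nonneg (weight_pos hδ Q (x i)).le (by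
    rw [dotProduct_mulVec_self]; positivity)

lemma TwoHyperplaneCondition.eq_zero_of_weightedInner (hx : TwoHyperplaneCondition x)
    (hδ : 0 < δ) {Q R : Matrix (Fin D) (Fin D) ℝ} (h : weightedInner δ x Q R R = 0) : R = 0 := by
  refine hx.eq_zero_of_mulVec fun i => ?_
  have h1 := (Finset.sum_eq_zero_iff_of_nonneg fun i _ => mul_nonneg (weight_pos hδ Q (x i)).le (by
    rw [dotProduct_mulVec_self]; positivity)).1 h i (Finset.mem_univ i)
  exact dotProduct_self_eq_zero.1 ((mul_eq_zero.1 h1).resolve_left (weight_pos hδ Q (x i)).ne')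

/-- Quadratic majorization of the energy. -/
lemma regEnergy_le (hδ : 0 < δ) (Q R : Matrix (Fin D) (Fin D) ℝ) :
    regEnergy δ x R ≤ regEnergy δ x Q +
      (weightedInner δ x Q R R - weightedInner δ x Q Q Q) / 2 := by
  have h : regEnergy δ x Q + (weightedInner δ x Q R R - weightedInner δ x Q Q Q) / 2 =
      ∑ i, (residual R (x i) ^ 2 / (2 * max (residual Q (x i)) δ) +
        max (residual Q (x i)) δ / 2) := by
    rw [regEnergy_eq, weightedInner, weightedInner, ← Finset.sum_sub_distrib, Finset.sum_div,
      ← Finset.sum_add_distrib]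
    refine Finset.sum_congr rfl fun i _ => ?_
    rw [dotProduct_mulVec_self, dotProduct_mulVec_self]
    have := hδ.trans_le (le_max_right (residual Q (x i)) δ)
    field_simp
    ring
  rw [h, regEnergy_eq]
  exact Finset.sum_le_sum fun i _ => huber_le_quadratic hδ (residual_nonneg _ _)

end Energy

/-! ### The IRLS step as a constrained least-squares minimizer -/

section Step

variable {D N : ℕ} {δ : ℝ} {x : Fin N → EuclideanSpace ℝ (Fin D)}

lemma dotProduct_weightedCov_mulVec (Q : Matrix (Fin D) (Fin D) ℝ) (v : Fin D → ℝ) :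
    v ⬝ᵥ (weightedCov δ x Q *ᵥ v) =
      ∑ i, (max (residual Q (x i)) δ)⁻¹ * ((x i).ofLp ⬝ᵥ v) ^ 2 := by
  simp only [weightedCov, sum_mulVec, dotProduct_sum, smul_mulVec, dotProduct_smul,
    smul_eq_mul, vecMulVec_mulVec]
  refine Finset.sum_congr rfl fun i _ => ?_
  rw [dotProduct_comm v]
  simp [sq]

lemma TwoHyperplaneCondition.posDef_weightedCov (hx : TwoHyperplaneCondition x) (hδ : 0 < δ)
    (Q : Matrix (Fin D) (Fin D) ℝ) : (weightedCov δ x Q).PosDef := by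
  refine PosDef.of_dotProduct_mulVec_pos ?_ fun {v} hv => ?_
  · simp [IsHermitian, weightedCov, transpose_sum, transpose_vecMulVec]
  · have hnn (i) (_ : i ∈ Finset.univ) :
        0 ≤ (max (residual Q (x i)) δ)⁻¹ * ((x i).ofLp ⬝ᵥ v) ^ 2 :=
      mul_nonneg (weight_pos hδ Q (x i)).le (sq_nonneg _)
    rw [star_trivial, dotProduct_weightedCov_mulVec]
    refine (Finset.sum_nonneg hnn).lt_of_ne' fun h => hv (hx.eq_zero_of_dotProduct fun i => ?_)
    have h1 := (Finset.sum_eq_zero_iff_of_nonneg hnn).1 h i (Finset.mem_univ i)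
    exact pow_eq_zero_iff two_ne_zero |>.1
      ((mul_eq_zero.1 h1).resolve_left (weight_pos hδ Q (x i)).ne')

lemma TwoHyperplaneCondition.trace_inv_pos (hD : 0 < D) (hx : TwoHyperplaneCondition x)
    (hδ : 0 < δ) (Q : Matrix (Fin D) (Fin D) ℝ) : 0 < (weightedCov δ x Q)⁻¹.trace :=
  have : Nonempty (Fin D) := ⟨⟨0, hD⟩⟩
  (hx.posDef_weightedCov hδ Q).inv.trace_pos

lemma TwoHyperplaneCondition.posDef_irlsStep (hD : 0 < D) (hx : TwoHyperplaneCondition x)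
    (hδ : 0 < δ) (Q : Matrix (Fin D) (Fin D) ℝ) : (irlsStep δ x Q).PosDef :=
  (hx.posDef_weightedCov hδ Q).inv.smul (inv_pos.2 (hx.trace_inv_pos hD hδ Q))

lemma TwoHyperplaneCondition.irlsStep_mem (hD : 0 < D) (hx : TwoHyperplaneCondition x)
    (hδ : 0 < δ) (Q : Matrix (Fin D) (Fin D) ℝ) : irlsStep δ x Q ∈ traceOne D := by
  refine ⟨?_, ?_⟩
  · have := (hx.posDef_irlsStep hD hδ Q).isHermitian
    simpa [IsHermitian, IsSymm] using this
  · rw [irlsStep, trace_smul, smul_eq_mul, inv_mul_cancel₀ (hx.trace_inv_pos hD hδ Q).ne']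

lemma TwoHyperplaneCondition.continuous_irlsStep (hD : 0 < D) (hx : TwoHyperplaneCondition x)
    (hδ : 0 < δ) : Continuous (irlsStep δ x) := by
  have hA : Continuous (weightedCov δ x) :=
    continuous_finsetSum _ fun i _ => (continuous_weight hδ (x i)).smul continuous_const
  have hinv : Continuous fun Q => (weightedCov δ x Q)⁻¹ := by
    simp only [inv_def, Ring.inverse_eq_inv']
    exact (hA.matrix_det.inv₀ fun Q => (hx.posDef_weightedCov hδ Q).det_pos.ne').smul
      hA.matrix_adjugate
  exact (hinv.matrix_trace.inv₀ fun Q => (hx.trace_inv_pos hD hδ Q).ne').smul hinv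

/-- The step is orthogonal, in the weighted inner product, to all traceless matrices. -/
lemma TwoHyperplaneCondition.weightedInner_irlsStep (hx : TwoHyperplaneCondition x) (hδ : 0 < δ)
    (Q R : Matrix (Fin D) (Fin D) ℝ) (hR : R.trace = 0) :
    weightedInner δ x Q (irlsStep δ x Q) R = 0 := by
  have hdet : IsUnit (weightedCov δ x Q).det :=
    (hx.posDef_weightedCov hδ Q).det_pos.ne'.isUnit
  -- The step times the covariance is a scalar matrix, so the pairing is a multiple of `R.trace`.
  rw [weightedInner_eq_trace, irlsStep, smul_mul, nonsing_inv_mul _ hdet, smul_mul, one_mul,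
    trace_smul, trace_transpose, hR, smul_zero]

/-- Pythagoras: the difference of two trace-one matrices is traceless. -/
lemma TwoHyperplaneCondition.weightedInner_eq_add (hD : 0 < D) (hx : TwoHyperplaneCondition x)
    (hδ : 0 < δ) (Q : Matrix (Fin D) (Fin D) ℝ) {R : Matrix (Fin D) (Fin D) ℝ}
    (hR : R ∈ traceOne D) :
    weightedInner δ x Q R R = weightedInner δ x Q (irlsStep δ x Q) (irlsStep δ x Q) +
      weightedInner δ x Q (R - irlsStep δ x Q) (R - irlsStep δ x Q) := by
  have htr : (R - irlsStep δ x Q).trace = 0 := by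
    rw [trace_sub, hR.2, (hx.irlsStep_mem hD hδ Q).2, sub_self]
  have h := weightedInner_add_self (δ := δ) (x := x) Q (irlsStep δ x Q) (R - irlsStep δ x Q)
  rwa [hx.weightedInner_irlsStep hδ Q _ htr, mul_zero, add_zero, add_sub_cancel] at h

lemma TwoHyperplaneCondition.regEnergy_irlsStep_le (hD : 0 < D) (hx : TwoHyperplaneCondition x)
    (hδ : 0 < δ) (Q : Matrix (Fin D) (Fin D) ℝ) {R : Matrix (Fin D) (Fin D) ℝ}
    (hR : R ∈ traceOne D) :
    regEnergy δ x (irlsStep δ x Q) ≤ regEnergy δ x Q + (weightedInner δ x Q R R -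
      weightedInner δ x Q (R - irlsStep δ x Q) (R - irlsStep δ x Q) -
        weightedInner δ x Q Q Q) / 2 := by
  have h1 := regEnergy_le (x := x) hδ Q (irlsStep δ x Q)
  have h2 := hx.weightedInner_eq_add hD hδ Q hR
  linarith

lemma TwoHyperplaneCondition.regEnergy_irlsStep_le_self (hD : 0 < D)
    (hx : TwoHyperplaneCondition x) (hδ : 0 < δ) {Q : Matrix (Fin D) (Fin D) ℝ}
    (hQ : Q ∈ traceOne D) : regEnergy δ x (irlsStep δ x Q) ≤ regEnergy δ x Q := by
  have h1 := hx.regEnergy_irlsStep_le hD hδ Q hQ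
  have h2 := weightedInner_self_nonneg (x := x) hδ Q (Q - irlsStep δ x Q)
  linarith

/-- With `R = Q`, the descent inequality gains half the weighted square of `Q - irlsStep δ x Q`,
which minimality forces to vanish. -/
lemma TwoHyperplaneCondition.irlsStep_eq_of_isMinOn (hD : 0 < D)
    (hx : TwoHyperplaneCondition x) (hδ : 0 < δ) {Q : Matrix (Fin D) (Fin D) ℝ}
    (hQ : Q ∈ traceOne D) (hmin : IsMinOn (regEnergy δ x) (traceOne D) Q) :
    irlsStep δ x Q = Q := by
  have h1 := hx.regEnergy_irlsStep_le hD hδ Q hQ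
  have h2 := weightedInner_self_nonneg (x := x) hδ Q (Q - irlsStep δ x Q)
  have h3 : regEnergy δ x Q ≤ regEnergy δ x (irlsStep δ x Q) := hmin (hx.irlsStep_mem hD hδ Q)
  exact (sub_eq_zero.1 (hx.eq_zero_of_weightedInner hδ (Q := Q) (by linarith))).symm

end Step

/-! ### Density matrices and existence of a minimizer -/

section Compactness

variable {D N : ℕ} {δ : ℝ} {x : Fin N → EuclideanSpace ℝ (Fin D)}

/-- The density matrices: positive semidefinite of trace one. -/
def density (D : ℕ) : Set (Matrix (Fin D) (Fin D) ℝ) :=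
  {Q | Q.PosSemidef ∧ Q.trace = 1}

lemma density_subset : density D ⊆ traceOne D := fun Q hQ =>
  ⟨by simpa [IsHermitian, IsSymm] using hQ.1.isHermitian, hQ.2⟩

lemma abs_apply_le_one_of_mem_density {Q : Matrix (Fin D) (Fin D) ℝ} (hQ : Q ∈ density D)
    (i j : Fin D) : |Q i j| ≤ 1 := by
  have hsymm : Q j i = Q i j := (density_subset hQ).1.apply i j
  have hdiag (k : Fin D) : Q k k ≤ 1 := by
    rw [← hQ.2, trace]
    exact Finset.single_le_sum (f := fun k => Q.diag k) (fun l _ => hQ.1.diag_nonneg)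
      (Finset.mem_univ k)
  -- Testing on `eᵢ ± eⱼ` gives `2 |Qᵢⱼ| ≤ Qᵢᵢ + Qⱼⱼ`.
  have h1 := hQ.1.dotProduct_mulVec_nonneg (Pi.single i 1 + Pi.single j 1)
  have h2 := hQ.1.dotProduct_mulVec_nonneg (Pi.single i 1 - Pi.single j 1)
  simp [mulVec_add, mulVec_sub, hsymm] at h1 h2
  rw [abs_le]
  constructor <;> linarith [hdiag i, hdiag j]

lemma isCompact_density : IsCompact (density D) := by
  have hbox : IsCompact (Set.univ.pi fun _ : Fin D => Set.univ.pi fun _ : Fin D =>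
      Set.Icc (-1 : ℝ) 1) :=
    isCompact_univ_pi fun _ => isCompact_univ_pi fun _ => isCompact_Icc
  refine IsCompact.of_isClosed_subset (X := Fin D → Fin D → ℝ) hbox ?_ fun Q hQ i _ j _ =>
    abs_le.1 (abs_apply_le_one_of_mem_density hQ i j)
  have : density D = {Q | Qᵀ = Q} ∩
      (⋂ v : Fin D → ℝ, {Q | 0 ≤ v ⬝ᵥ (Q *ᵥ v)}) ∩ {Q | Q.trace = 1} := by
    ext Q
    simp [density, posSemidef_iff_dotProduct_mulVec, IsHermitian]
  change IsClosed (density D : Set (Matrix (Fin D) (Fin D) ℝ))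
  rw [this]
  refine ((isClosed_eq continuous_id.matrix_transpose continuous_id).inter
    (isClosed_iInter fun v => isClosed_le continuous_const ?_)).inter
      (isClosed_eq continuous_id.matrix_trace continuous_const)
  exact continuous_const.dotProduct (continuous_id.matrix_mulVec continuous_const)

lemma TwoHyperplaneCondition.irlsStep_mem_density (hD : 0 < D) (hx : TwoHyperplaneCondition x)
    (hδ : 0 < δ) (Q : Matrix (Fin D) (Fin D) ℝ) : irlsStep δ x Q ∈ density D :=
  ⟨(hx.posDef_irlsStep hD hδ Q).posSemidef, (hx.irlsStep_mem hD hδ Q).2⟩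

/-- Minimizing over density matrices suffices, since one step moves any competitor there without
raising the energy. -/
lemma TwoHyperplaneCondition.exists_isMinOn (hD : 0 < D) (hx : TwoHyperplaneCondition x)
    (hδ : 0 < δ) : ∃ Q ∈ density D, IsMinOn (regEnergy δ x) (traceOne D) Q := by
  obtain ⟨Q, hQ, hmin⟩ := isCompact_density.exists_isMinOn
    ⟨_, hx.irlsStep_mem_density hD hδ 0⟩ (continuous_regEnergy (x := x) hδ).continuousOn
  exact ⟨Q, hQ, fun R hR => (hmin (hx.irlsStep_mem_density hD hδ R)).trans
    (hx.regEnergy_irlsStep_le_self hD hδ hR)⟩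

end Compactness

/-! ### Uniform strong convexity and smoothness -/

section StrongConvexity

variable {D N : ℕ} {δ : ℝ} {x : Fin N → EuclideanSpace ℝ (Fin D)}

/-- On a compact set of positive definite matrices, the total Gram determinant is bounded below
by a multiple of the squared norm of a symmetric traceless direction. -/
lemma TwoHyperplaneCondition.exists_le_sum_gramDet (hD : 0 < D) (hx : TwoHyperplaneCondition x)
    {K : Set (Matrix (Fin D) (Fin D) ℝ)} (hK : IsCompact K) (hpos : ∀ Q ∈ K, Q.PosDef) :
    ∃ μ : ℝ, 0 < μ ∧ ∀ Q ∈ K, ∀ P : Matrix (Fin D) (Fin D) ℝ, P.trace = 0 →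
      μ * ‖P‖ ^ 2 ≤ ∑ i, gramDet (Q *ᵥ (x i).ofLp) (P *ᵥ (x i).ofLp) := by
  have : Nonempty (Fin D) := ⟨⟨0, hD⟩⟩
  have : ProperSpace (Matrix (Fin D) (Fin D) ℝ) := FiniteDimensional.proper_real _
  let S : Set (Matrix (Fin D) (Fin D) ℝ) := Metric.sphere 0 1 ∩ {P | P.trace = 0}
  have hS : IsCompact S := (isCompact_sphere _ _).inter_right
    (isClosed_eq continuous_id.matrix_trace continuous_const)
  have hcont : Continuous fun p : Matrix (Fin D) (Fin D) ℝ × Matrix (Fin D) (Fin D) ℝ =>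
      ∑ i, gramDet (p.1 *ᵥ (x i).ofLp) (p.2 *ᵥ (x i).ofLp) := by
    refine continuous_finsetSum _ fun i _ => ?_
    have h1 : Continuous fun p : Matrix (Fin D) (Fin D) ℝ × Matrix (Fin D) (Fin D) ℝ =>
      p.1 *ᵥ (x i).ofLp := continuous_fst.matrix_mulVec continuous_const
    have h2 : Continuous fun p : Matrix (Fin D) (Fin D) ℝ × Matrix (Fin D) (Fin D) ℝ =>
      p.2 *ᵥ (x i).ofLp := continuous_snd.matrix_mulVec continuous_const
    exact ((h1.dotProduct h1).mul (h2.dotProduct h2)).sub ((h1.dotProduct h2).pow 2)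
  obtain ⟨μ, hμ, h⟩ := (hK.prod hS).exists_forall_le' hcont.continuousOn (a := 0) (by
    rintro ⟨Q, P⟩ ⟨hQ, hP1, hP2⟩
    have hnn (i) (_ : i ∈ Finset.univ) :
      0 ≤ gramDet (Q *ᵥ (x i).ofLp) (P *ᵥ (x i).ofLp) := gramDet_nonneg _ _
    refine (Finset.sum_nonneg hnn).lt_of_ne' fun h => ?_
    have hz := (Finset.sum_eq_zero_iff_of_nonneg hnn).1 h
    have hQd := (hpos Q hQ).det_pos.ne'.isUnit
    have hP0 : P = 0 := by
      refine hx.eq_zero_of_parallel hD hQd (hpos Q hQ).trace_pos.ne' hP2 fun i => ?_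
      by_cases hi : Q *ᵥ (x i).ofLp = 0
      · have hxi : (x i).ofLp = 0 := by
          rw [← one_mulVec (x i).ofLp, ← nonsing_inv_mul _ hQd, ← mulVec_mulVec, hi, mulVec_zero]
        exact ⟨0, by rw [hxi, mulVec_zero, zero_smul]⟩
      · exact exists_smul_eq_of_gramDet_eq_zero hi (hz i (Finset.mem_univ i))
    simp [hP0] at hP1)
  refine ⟨μ, hμ, fun Q hQ P hP => ?_⟩
  rcases eq_or_ne P 0 with rfl | hP0
  · simp [gramDet]
  have hn : ‖P‖ ≠ 0 := norm_ne_zero_iff.2 hP0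
  have h1 := h (Q, ‖P‖⁻¹ • P) ⟨hQ, by simp [norm_smul, hn], by simp [trace_smul, hP]⟩
  simp only [smul_mulVec, gramDet_smul_right, ← Finset.mul_sum] at h1
  rw [inv_pow, ← div_eq_inv_mul, le_div_iff₀ (by positivity)] at h1
  exact h1

lemma exists_residual_le (x : Fin N → EuclideanSpace ℝ (Fin D)) (δ : ℝ) :
    ∃ M : ℝ, δ ≤ M ∧ ∀ Q ∈ density D, ∀ i, residual Q (x i) ≤ M := by
  obtain ⟨M, hM⟩ := isCompact_density.bddAbove_image (f := fun Q => ∑ i, residual Q (x i))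
    (continuous_finsetSum _ fun i _ => continuous_residual (D := D) (x i)).continuousOn
  refine ⟨max δ M, le_max_left _ _, fun Q hQ i => le_max_of_le_right ?_⟩
  exact (Finset.single_le_sum (f := fun i => residual Q (x i))
    (fun j _ => residual_nonneg Q (x j)) (Finset.mem_univ i)).trans (hM ⟨Q, hQ, rfl⟩)

/-- Strong convexity of the energy along segments from a compact set of positive definite
density matrices. -/
lemma TwoHyperplaneCondition.exists_strongConvexity (hD : 0 < D) (hx : TwoHyperplaneCondition x)
    (hδ : 0 < δ) {K : Set (Matrix (Fin D) (Fin D) ℝ)} (hK : IsCompact K)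
    (hKd : K ⊆ density D) (hpos : ∀ Q ∈ K, Q.PosDef) :
    ∃ μ : ℝ, 0 < μ ∧ ∀ Q ∈ K, ∀ R ∈ density D,
      regEnergy δ x Q + weightedInner δ x Q Q (R - Q) + μ * ‖R - Q‖ ^ 2 ≤ regEnergy δ x R := by
  obtain ⟨M, hδM, hM⟩ := exists_residual_le x δ
  obtain ⟨μ, hμ, h⟩ := hx.exists_le_sum_gramDet hD hK hpos
  have hM0 : 0 < M := hδ.trans_le hδM
  refine ⟨(2 * M ^ 3)⁻¹ * μ, by positivity, fun Q hQ R hR => ?_⟩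
  have h1 := h Q hQ (R - Q) (by rw [trace_sub, hR.2, (hKd hQ).2, sub_self])
  have h2 : (2 * M ^ 3)⁻¹ * μ * ‖R - Q‖ ^ 2 ≤
      ∑ i, (2 * M ^ 3)⁻¹ * gramDet (Q *ᵥ (x i).ofLp) ((R - Q) *ᵥ (x i).ofLp) := by
    rw [← Finset.mul_sum, mul_assoc]
    gcongr
  refine (add_le_add_right h2 _).trans ?_
  rw [regEnergy_eq, regEnergy_eq, weightedInner, ← Finset.sum_add_distrib,
    ← Finset.sum_add_distrib]
  refine Finset.sum_le_sum fun i _ => ?_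
  rw [sub_mulVec, gramDet_sub_right]
  exact gramDet_le_bregman hδ (residual_nonneg _ _) (residual_nonneg _ _)
    (dotProduct_mulVec_self _ _) (dotProduct_mulVec_self _ _) (hM Q (hKd hQ) i) (hM R hR i) hδM

/-- The weighted inner product is bounded, uniformly in the weights. -/
lemma exists_weightedInner_le (x : Fin N → EuclideanSpace ℝ (Fin D)) (hδ : 0 < δ) :
    ∃ L : ℝ, ∀ Q P : Matrix (Fin D) (Fin D) ℝ, weightedInner δ x Q P P ≤ L * ‖P‖ ^ 2 := by
  have : ProperSpace (Matrix (Fin D) (Fin D) ℝ) := FiniteDimensional.proper_real _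
  obtain ⟨L, hL⟩ := (isCompact_sphere (0 : Matrix (Fin D) (Fin D) ℝ) 1).bddAbove_image
    (f := fun P => ∑ i, δ⁻¹ * ((P *ᵥ (x i).ofLp) ⬝ᵥ (P *ᵥ (x i).ofLp)))
    (continuous_finsetSum _ fun i _ => continuous_const.mul <|
      (continuous_id.matrix_mulVec continuous_const).dotProduct
        (continuous_id.matrix_mulVec continuous_const)).continuousOn
  refine ⟨L, fun Q P => ?_⟩
  have h0 : weightedInner δ x Q P P ≤
      ∑ i, δ⁻¹ * ((P *ᵥ (x i).ofLp) ⬝ᵥ (P *ᵥ (x i).ofLp)) := by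
    refine Finset.sum_le_sum fun i _ => ?_
    rw [dotProduct_mulVec_self]
    gcongr
    exact le_max_right _ _
  refine h0.trans ?_
  rcases eq_or_ne P 0 with rfl | hP0
  · simp
  have hn : ‖P‖ ≠ 0 := norm_ne_zero_iff.2 hP0
  have h1 := hL ⟨‖P‖⁻¹ • P, by simp [norm_smul, hn], rfl⟩
  have h2 (i : Fin N) : δ⁻¹ * (((‖P‖⁻¹ • P) *ᵥ (x i).ofLp) ⬝ᵥ ((‖P‖⁻¹ • P) *ᵥ (x i).ofLp)) =
      (‖P‖ ^ 2)⁻¹ * (δ⁻¹ * ((P *ᵥ (x i).ofLp) ⬝ᵥ (P *ᵥ (x i).ofLp))) := by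
    simp only [smul_mulVec, dotProduct_smul, smul_dotProduct, smul_eq_mul]
    ring
  simp only [h2, ← Finset.mul_sum] at h1
  rw [← div_eq_inv_mul, div_le_iff₀ (by positivity)] at h1
  rwa [← Finset.mul_sum]

end StrongConvexity

/-! ### Contraction of the energy gap -/

section Rate

variable {D N : ℕ} {δ : ℝ} {x : Fin N → EuclideanSpace ℝ (Fin D)}

lemma traceOne_lineMap {Q R : Matrix (Fin D) (Fin D) ℝ} (hQ : Q ∈ traceOne D)
    (hR : R ∈ traceOne D) (t : ℝ) : Q + t • (R - Q) ∈ traceOne D := by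
  refine ⟨hQ.1.add ((hR.1.sub hQ.1).smul t), ?_⟩
  rw [trace_add, trace_smul, trace_sub, hQ.2, hR.2, sub_self, smul_zero, add_zero]

/-- One step contracts the energy gap where the energy is strongly convex. -/
lemma TwoHyperplaneCondition.regEnergy_irlsStep_sub_le (hD : 0 < D)
    (hx : TwoHyperplaneCondition x) (hδ : 0 < δ) {μ L : ℝ} (hμ : 0 < μ) (hμL : μ ≤ L)
    {Q R : Matrix (Fin D) (Fin D) ℝ} (hQ : Q ∈ traceOne D) (hR : R ∈ traceOne D)
    (hconv : regEnergy δ x Q + weightedInner δ x Q Q (R - Q) + μ * ‖R - Q‖ ^ 2 ≤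
      regEnergy δ x R)
    (hbound : weightedInner δ x Q (R - Q) (R - Q) ≤ L * ‖R - Q‖ ^ 2) :
    regEnergy δ x (irlsStep δ x Q) - regEnergy δ x R ≤
      (1 - μ / L) * (regEnergy δ x Q - regEnergy δ x R) := by
  have hL : 0 < L := hμ.trans_le hμL
  -- Compare the step with the point a fraction `t = μ / L` of the way to `R`: the quadratic cost
  -- `t² L / 2` is then `t μ / 2`, less than the convexity gain `t μ`.
  have h1 := hx.regEnergy_irlsStep_le hD hδ Q (traceOne_lineMap hQ hR (μ / L))
  have h2 := weightedInner_self_nonneg (x := x) hδ Q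
    (Q + (μ / L) • (R - Q) - irlsStep δ x Q)
  rw [weightedInner_add_self, weightedInner_smul_right, weightedInner_smul_right,
    weightedInner_comm Q ((μ / L) • (R - Q)), weightedInner_smul_right] at h1
  have ht : 0 < μ / L := by positivity
  have htL : μ / L * L = μ := by field_simp
  generalize μ / L = t at *
  have h3 := mul_le_mul_of_nonneg_left hconv ht.le
  have h4 := mul_le_mul_of_nonneg_left (mul_le_mul_of_nonneg_left hbound ht.le) ht.le
  have h5 : t * (t * (L * ‖R - Q‖ ^ 2)) = t * (μ * ‖R - Q‖ ^ 2) := by rw [← htL]; ring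
  have h6 : 0 ≤ t * (μ * ‖R - Q‖ ^ 2) := by positivity
  nlinarith

end Rate

end IRLS

/-! ### Linear convergence -/

open IRLS

/-- Linear convergence of the regularized IRLS iteration; the norm in the last line is the
Frobenius norm. If `D = 0`, then no matrix of trace one exists, hence `0 < D`. -/
theorem mainTheorem2 {D N : ℕ} (hD : 0 < D) (δ : ℝ) (hδ : 0 < δ)
    (x : Fin N → EuclideanSpace ℝ (Fin D)) (hx : IRLS.TwoHyperplaneCondition x) :
    ∃ Qhat : Matrix (Fin D) (Fin D) ℝ, IRLS.IsUniqueMinimizer δ x Qhat ∧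
      ∃ r : ℝ, 0 < r ∧ r < 1 ∧
        ∀ Q₀ ∈ IRLS.traceOne D,
          (∀ k : ℕ, IsUnit (IRLS.weightedCov δ x (IRLS.irlsSeq δ x Q₀ k)).det ∧
            (IRLS.weightedCov δ x (IRLS.irlsSeq δ x Q₀ k))⁻¹.trace ≠ 0) ∧
          ∃ C : ℝ, 0 < C ∧
            ∀ k : ℕ, ‖IRLS.irlsSeq δ x Q₀ k - Qhat‖ ≤ C * r ^ k := by
  let K := irlsStep δ x '' density D
  have hK : IsCompact K := isCompact_density.image (hx.continuous_irlsStep hD hδ)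
  have hKd : K ⊆ density D := by
    rintro _ ⟨Q, -, rfl⟩
    exact hx.irlsStep_mem_density hD hδ Q
  have hKpos : ∀ Q ∈ K, Q.PosDef := by
    rintro _ ⟨Q, -, rfl⟩
    exact hx.posDef_irlsStep hD hδ Q
  obtain ⟨μ, hμ, hconv⟩ := hx.exists_strongConvexity hD hδ hK hKd hKpos
  obtain ⟨L₀, hL₀⟩ := exists_weightedInner_le x hδ
  -- Taking `L ≥ 2 μ` keeps the contraction factor `1 - μ / L` positive.
  obtain ⟨L, hLμ, hL⟩ : ∃ L, 2 * μ ≤ L ∧ ∀ Q P : Matrix (Fin D) (Fin D) ℝ,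
      weightedInner δ x Q P P ≤ L * ‖P‖ ^ 2 :=
    ⟨max (2 * μ) L₀, le_max_left _ _, fun Q P => (hL₀ Q P).trans
      (mul_le_mul_of_nonneg_right (le_max_right _ _) (sq_nonneg _))⟩
  have hminK : ∀ Q ∈ traceOne D, IsMinOn (regEnergy δ x) (traceOne D) Q → Q ∈ K := by
    intro Q hQ hmin
    have hfix := hx.irlsStep_eq_of_isMinOn hD hδ hQ hmin
    exact ⟨Q, hfix ▸ hx.irlsStep_mem_density hD hδ Q, hfix⟩
  obtain ⟨Qhat, hQd, hmin⟩ := hx.exists_isMinOn hD hδ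
  have hQt : Qhat ∈ traceOne D := density_subset hQd
  have hgrowth : ∀ R ∈ density D,
      μ * ‖R - Qhat‖ ^ 2 ≤ regEnergy δ x R - regEnergy δ x Qhat := by
    intro R hR
    have h1 := hconv Qhat (hminK Qhat hQt hmin) R hR
    -- The first-order term vanishes because `Qhat` is its own step.
    have h2 := hx.weightedInner_irlsStep hδ Qhat (R - Qhat)
      (by rw [Matrix.trace_sub, hR.2, hQd.2, sub_self])
    rw [hx.irlsStep_eq_of_isMinOn hD hδ hQt hmin] at h2
    linarith
  refine ⟨Qhat, ⟨⟨hQt, hmin⟩, fun Q hQ hQmin => ?_⟩, ?_⟩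
  · have h1 := hgrowth Q (hKd (hminK Q hQ hQmin))
    have h2 : regEnergy δ x Q ≤ regEnergy δ x Qhat := hQmin hQt
    have h3 : ‖Q - Qhat‖ ^ 2 ≤ 0 := by nlinarith
    have h4 : ‖Q - Qhat‖ = 0 := pow_eq_zero_iff two_ne_zero |>.1 (h3.antisymm (sq_nonneg _))
    exact sub_eq_zero.1 (norm_eq_zero.1 h4)
  have hLpos : 0 < L := by linarith
  set q := 1 - μ / L with hq
  have hq0 : 0 < q := by
    have : μ / L < 1 := (div_lt_one hLpos).2 (by linarith)
    linarith
  have hq1 : q < 1 := by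
    have : 0 < μ / L := by positivity
    linarith
  have hr : √q ^ 2 = q := Real.sq_sqrt hq0.le
  refine ⟨√q, Real.sqrt_pos.2 hq0, by rw [Real.sqrt_lt' one_pos]; linarith, fun Q₀ hQ₀ =>
    ⟨fun k => ⟨(hx.posDef_weightedCov hδ _).det_pos.ne'.isUnit,
      (hx.trace_inv_pos hD hδ _).ne'⟩, ?_⟩⟩
  -- `Q₀` need not be positive semidefinite: one step reaches the density matrices, a second reaches
  -- `K`.
  have hmem (k : ℕ) : irlsSeq δ x Q₀ (k + 2) ∈ K := ⟨_, hx.irlsStep_mem_density hD hδ _, rfl⟩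
  set g := regEnergy δ x (irlsSeq δ x Q₀ 2) - regEnergy δ x Qhat with hg
  have hgap (k : ℕ) :
      regEnergy δ x (irlsSeq δ x Q₀ (k + 2)) - regEnergy δ x Qhat ≤ q ^ k * g := by
    induction k with
    | zero => simp [hg]
    | succ k ih =>
      have h1 := hx.regEnergy_irlsStep_sub_le hD hδ hμ (by linarith)
        (density_subset (hKd (hmem k))) hQt (hconv _ (hmem k) _ hQd) (hL _ _)
      calc _ ≤ q * (regEnergy δ x (irlsSeq δ x Q₀ (k + 2)) - regEnergy δ x Qhat) := h1
        _ ≤ q * (q ^ k * g) := by gcongr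
        _ = q ^ (k + 1) * g := by ring
  have hdist (k : ℕ) : ‖irlsSeq δ x Q₀ (k + 2) - Qhat‖ ≤ √(g / μ) * √q ^ k := by
    have hg0 : 0 ≤ g := sub_nonneg.2 (hmin (density_subset (hKd (hmem 0))))
    refine abs_le_of_sq_le_sq' ?_ (by positivity) |>.2
    rw [mul_pow, Real.sq_sqrt (by positivity), ← pow_mul, mul_comm k 2, pow_mul, hr,
      div_mul_eq_mul_div, le_div_iff₀ hμ]
    linarith [hgrowth _ (hKd (hmem k)), hgap k]
  have hs : 0 < √q := Real.sqrt_pos.2 hq0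
  let a := ‖irlsSeq δ x Q₀ 0 - Qhat‖
  let b := ‖irlsSeq δ x Q₀ 1 - Qhat‖
  have ha0 : 0 ≤ a := norm_nonneg _
  have hb0 : 0 ≤ b := norm_nonneg _
  have hc0 : 0 ≤ √(g / μ) := Real.sqrt_nonneg _
  -- The terms `a` and `b / √q` absorb the indices `0` and `1`; division by `√q ^ 2` undoes the
  -- shift by two.
  refine ⟨1 + a + b / √q + √(g / μ) / √q ^ 2, by positivity, fun k => ?_⟩
  have hb' : 0 ≤ b / √q := by positivity
  have hc' : 0 ≤ √(g / μ) / √q ^ 2 := by positivity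
  match k with
  | 0 => rw [pow_zero, mul_one]; linarith
  | 1 =>
    calc b = b / √q * √q ^ 1 := by field_simp
      _ ≤ _ := by gcongr; linarith
  | k + 2 =>
    calc _ ≤ √(g / μ) * √q ^ k := hdist k
      _ = √(g / μ) / √q ^ 2 * √q ^ (k + 2) := by field_simp; ring
      _ ≤ _ := by gcongr; linarith
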